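/- Let $\mathbb{T}$ be the circle group with normalized Haar (Lebesgue) measure $d\theta$, $\int_{\mathbb T}d\theta=1$. For a finite complex Borel measure $\mu$ on $\mathbb{T}$ and $n\in\mathbb{Z}$ let $\hat\mu(n)=\int_{\mathbb{T}} \overline{z^n}\,d\mu(z)$, and for $f\in L^1(\mathbb{T})$ let $\hat f(n)=\int_{\mathbb{T}} f\,\overline{z^n}\,d\theta$. Let $M_r(\mathbb{T})$ be the set of finite complex Borel measures $\mu$ on $\mathbb{T}$ with $\hat\mu(n)\in\mathbb{R}$ for all $n\in\mathbb{Z}$, and let $H^1_r(\mathbb{T})$ be the set of $f\in L^1(\mathbb{T})$ with $\hat f(n)\in\mathbb{R}$ for all $n\in\mathbb{Z}$ and $\hat f(n)=0$ for all $n<0$. Theorem. Let $\mu\in M_r(\mathbb{T})$ with $\hat\mu(n)=0$ for all $n<0$. Then $\mu$ is absolutely continuous with respect to $d\theta$, and there exists a function $f\in H^1_r(\mathbb{T})$ such that $d\mu=f\,d\theta$ and $\|\mu\|=\|f\|_1$, where $\|\mu\|$ is the total variation of $\mu$ and $\|f\|_1=\int_{\mathbb{T}}|f|\,d\theta$. 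-/

import Mathlib

noncomputable section

namespace RealHardy

open MeasureTheory AddCircle

variable (T : ℝ) [Fact (0 < T)]

/-- The `n`-th Fourier(–Stieltjes) coefficient `∫ conj (z ^ n) dμ` of a complex Borel measure on
the circle `AddCircle T`, where `z ^ n` is the character `fourier n`. -/
def measureFourierCoeff {T : ℝ} (μ : ComplexMeasure (AddCircle T)) (n : ℤ) : ℂ :=
  VectorMeasure.integral μ (fun t : AddCircle T => fourier (-n) t) (ContinuousLinearMap.mul ℝ ℂ)

/-- `M_r`: the complex Borel measures on the circle whose Fourier coefficients are all real. -/
def Mr (T : ℝ) : Set (ComplexMeasure (AddCircle T)) :=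
  {μ | ∀ n : ℤ, (measureFourierCoeff μ n).im = 0}

/-- `L¹_r`: the elements of `L¹` (for normalized Haar measure) with real Fourier coefficients. -/
def L1r : Set (Lp ℂ 1 (haarAddCircle (T := T))) :=
  {f | ∀ n : ℤ, (fourierCoeff f n).im = 0}

/-- The Hardy space `H¹`: the elements of `L¹` whose negative Fourier coefficients vanish. -/
def H1 : Set (Lp ℂ 1 (haarAddCircle (T := T))) :=
  {f | ∀ n : ℤ, n < 0 → fourierCoeff f n = 0}

/-- `H¹_r = L¹_r ∩ H¹`. -/
def H1r : Set (Lp ℂ 1 (haarAddCircle (T := T))) :=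
  L1r T ∩ H1 T

/-- The total variation norm of a complex measure. -/
def totalVariationNorm {T : ℝ} (μ : ComplexMeasure (AddCircle T)) : ENNReal :=
  μ.variation Set.univ

end RealHardy

end

/-! The substance is the F. and M. Riesz theorem, proved with peak functions. Write `μ = h ν` with
`ν` finite. Vanishing negative coefficients say that `μ` annihilates `z ^ k` for `k > 0`, hence `z *
G z` for every `G` holomorphic near the closed disc; the factor `z` is needed because the
coefficient at `0` is unrestricted. For a compact Lebesgue-null `K`, `exists_peak_function` gives
such `G`, bounded by `1`, that tend to the indicator of `K` on the circle. Dominated convergence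
yields `∫_K z dμ = 0`. Inner regularity extends this to null Borel sets, and since `z` never
vanishes, `μ` vanishes on them. Radon-Nikodym then gives the density `f`. It has the same Fourier
coefficients as `μ`, so it lies in `H1r`, and the variation of `f dθ` is `|f| dθ`. -/

namespace RealHardy

open MeasureTheory AddCircle Filter Topology Metric
open scoped ENNReal

/-! ### Complex measures as densities, and integration against them. -/

section ComplexMeasure

variable {α : Type*} [MeasurableSpace α]

/-- Radon-Nikodym for complex measures. -/
theorem exists_eq_withDensityᵥ_of_absolutelyContinuous (μ : ComplexMeasure α) (ν : Measure α)
    [SigmaFinite ν] (h : μ ≪ᵥ ν.toENNRealVectorMeasure) :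
    ∃ f : α → ℂ, Integrable f ν ∧ μ = ν.withDensityᵥ f := by
  obtain ⟨hre, him⟩ := (ComplexMeasure.absolutelyContinuous_ennreal_iff μ _).1 h
  set u := (ComplexMeasure.re μ).rnDeriv ν with hu
  set v := (ComplexMeasure.im μ).rnDeriv ν with hv
  have hui : Integrable u ν := SignedMeasure.integrable_rnDeriv _ _
  have hvi : Integrable v ν := SignedMeasure.integrable_rnDeriv _ _
  have hf : Integrable (fun x => (u x : ℂ) + (v x : ℂ) * Complex.I) ν :=
    hui.ofReal.add (hvi.ofReal.mul_const _)
  refine ⟨_, hf, ?_⟩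
  ext s hs
  have h1 := congrArg (fun m => m s) (SignedMeasure.withDensityᵥ_rnDeriv_eq _ ν hre)
  have h2 := congrArg (fun m => m s) (SignedMeasure.withDensityᵥ_rnDeriv_eq _ ν him)
  simp only [withDensityᵥ_apply hui hs, withDensityᵥ_apply hvi hs, ← hu, ← hv] at h1 h2
  have h3 : ∫ x in s, ((u x : ℂ) + (v x : ℂ) * Complex.I) ∂ν =
      ((∫ x in s, u x ∂ν : ℝ) : ℂ) + ((∫ x in s, v x ∂ν : ℝ) : ℂ) * Complex.I := by
    rw [integral_add hui.ofReal.restrict (hvi.ofReal.mul_const _).restrict, integral_mul_const]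
    congr 1
    · exact integral_ofReal
    · congr 1
      exact integral_ofReal
  rw [withDensityᵥ_apply hf hs, h3, h1, h2]
  exact (Complex.re_add_im _).symm

/-- The sum of the total variations of the real and imaginary parts dominates `μ`. This turns
integrals against `μ` into Bochner integrals against a positive measure. -/
theorem exists_finite_measure_eq_withDensityᵥ (μ : ComplexMeasure α) :
    ∃ (ν : Measure α) (_ : IsFiniteMeasure ν) (f : α → ℂ),
      Integrable f ν ∧ μ = ν.withDensityᵥ f := by
  have hfin : ∀ s : SignedMeasure α, IsFiniteMeasure s.totalVariation := fun s => by
    unfold SignedMeasure.totalVariation; infer_instance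
  have := hfin (ComplexMeasure.re μ)
  have := hfin (ComplexMeasure.im μ)
  refine ⟨(ComplexMeasure.re μ).totalVariation + (ComplexMeasure.im μ).totalVariation,
    inferInstance, exists_eq_withDensityᵥ_of_absolutelyContinuous _ _ ?_⟩
  rw [ComplexMeasure.absolutelyContinuous_ennreal_iff, SignedMeasure.absolutelyContinuous_ennreal_iff,
    SignedMeasure.absolutelyContinuous_ennreal_iff,
    show ∀ m : Measure α, m.toENNRealVectorMeasure.ennrealToMeasure = m from
      VectorMeasure.equivMeasure.apply_symm_apply]
  exact ⟨Measure.AbsolutelyContinuous.rfl.add_right _, by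
    rw [add_comm]; exact Measure.AbsolutelyContinuous.rfl.add_right _⟩

theorem isFiniteMeasure_variation_withDensityᵥ {ν : Measure α} {f : α → ℂ} (hf : Integrable f ν) :
    IsFiniteMeasure (ν.withDensityᵥ f).variation := by
  rw [Measure.variation_withDensityᵥ hf]
  exact isFiniteMeasure_withDensity hf.2.ne

theorem integral_withDensityᵥ_simpleFunc {ν : Measure α} {f : α → ℂ} (hf : Integrable f ν)
    (φ : SimpleFunc α ℂ) :
    (ν.withDensityᵥ f).integral φ (ContinuousLinearMap.mul ℝ ℂ) = ∫ x, φ x * f x ∂ν := by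
  have := isFiniteMeasure_variation_withDensityᵥ hf
  have hint : ∀ φ : SimpleFunc α ℂ, Integrable (fun x => φ x * f x) ν := fun φ => by
    obtain ⟨C, hC⟩ := φ.exists_forall_norm_le
    exact hf.bdd_mul φ.aestronglyMeasurable (Eventually.of_forall hC)
  refine SimpleFunc.induction (motive := fun φ => (ν.withDensityᵥ f).integral φ
    (ContinuousLinearMap.mul ℝ ℂ) = ∫ x, φ x * f x ∂ν) (fun c s hs => ?_)
    (fun φ ψ _ h1 h2 => ?_) φ
  · classical
    have hcoe : ⇑(SimpleFunc.piecewise s hs (SimpleFunc.const α c) (SimpleFunc.const α 0)) =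
        s.indicator (fun _ => c) := by
      ext x
      by_cases hx : x ∈ s <;> simp [hx]
    rw [hcoe]
    have h := VectorMeasure.integral_indicator (μ := ν.withDensityᵥ f)
      (B := ContinuousLinearMap.mul ℝ ℂ) (f := fun _ => c) hs
    rw [VectorMeasure.setIntegral_const, withDensityᵥ_apply hf hs,
      ContinuousLinearMap.mul_apply', ← integral_const_mul, ← integral_indicator hs] at h
    refine h.trans (integral_congr_ae (Eventually.of_forall fun x => ?_))
    by_cases hx : x ∈ s <;> simp [hx]
  · have h := VectorMeasure.integral_add (μ := ν.withDensityᵥ f)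
      (B := ContinuousLinearMap.mul ℝ ℂ) (φ.integrable_of_isFiniteMeasure)
      (ψ.integrable_of_isFiniteMeasure)
    rw [h1, h2, ← integral_add (hint φ) (hint ψ)] at h
    rw [SimpleFunc.coe_add]
    refine h.trans (integral_congr_ae (Eventually.of_forall fun x => ?_))
    simp [add_mul]

theorem integral_withDensityᵥ_of_bounded {ν : Measure α} {f φ : α → ℂ} (hf : Integrable f ν)
    (hφ : StronglyMeasurable φ) {C : ℝ} (hC : ∀ x, ‖φ x‖ ≤ C) (hC0 : 0 ≤ C) :
    (ν.withDensityᵥ f).integral φ (ContinuousLinearMap.mul ℝ ℂ) = ∫ x, φ x * f x ∂ν := by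
  have := isFiniteMeasure_variation_withDensityᵥ hf
  have h1 : Tendsto (fun n => (ν.withDensityᵥ f).integral (hφ.approxBounded C n)
      (ContinuousLinearMap.mul ℝ ℂ)) atTop
      (𝓝 ((ν.withDensityᵥ f).integral φ (ContinuousLinearMap.mul ℝ ℂ))) :=
    VectorMeasure.tendsto_integral_of_dominated_convergence (fun _ => C)
      (fun n => SimpleFunc.aestronglyMeasurable _) (integrable_const _)
      (fun n => Eventually.of_forall (hφ.norm_approxBounded_le hC0 n))
      (Eventually.of_forall fun x => hφ.tendsto_approxBounded_of_norm_le (hC x))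
  refine tendsto_nhds_unique h1 ?_
  simp_rw [integral_withDensityᵥ_simpleFunc hf]
  refine tendsto_integral_of_dominated_convergence (fun x => C * ‖f x‖)
    (fun n => (SimpleFunc.aestronglyMeasurable _).mul hf.1) (hf.norm.const_mul _)
    (fun n => Eventually.of_forall fun x => ?_)
    (Eventually.of_forall fun x => (hφ.tendsto_approxBounded_of_norm_le (hC x)).mul_const _)
  rw [norm_mul]
  gcongr
  exact hφ.norm_approxBounded_le hC0 n x

end ComplexMeasure

/-! ### Rational peak functions on the disc. -/

section PeakFunction

/-- For unit points `a ∈ s` this has positive real part on the ball of radius `1 + r`, and real part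
of size at least `M / 4` near each `a`. -/
noncomputable def poleSum (s : Finset ℂ) (r M : ℝ) (z : ℂ) : ℂ :=
  ∑ a ∈ s, (M * r : ℝ) * (1 + r - starRingEnd ℂ a * z)⁻¹

/-- A function bounded by `1` on the unit disc, close to `1` near `s` and small away from `s`. -/
noncomputable def peakFunction (s : Finset ℂ) (r M : ℝ) (z : ℂ) : ℂ :=
  poleSum s r M z / (1 + poleSum s r M z)

variable {s : Finset ℂ} {r M : ℝ} {z : ℂ}

theorem le_re_denominator {a : ℂ} (ha : ‖a‖ = 1) (z : ℂ) :
    1 + r - ‖z‖ ≤ (1 + r - starRingEnd ℂ a * z : ℂ).re := by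
  have h : (starRingEnd ℂ a * z).re ≤ ‖z‖ := by
    simpa [ha] using Complex.re_le_norm (starRingEnd ℂ a * z)
  simp only [Complex.sub_re, Complex.add_re, Complex.one_re, Complex.ofReal_re]
  linarith

theorem denominator_ne_zero {a : ℂ} (ha : ‖a‖ = 1) (hz : ‖z‖ < 1 + r) :
    (1 + r - starRingEnd ℂ a * z : ℂ) ≠ 0 := fun h => by
  have := le_re_denominator (r := r) ha z
  rw [h, Complex.zero_re] at this
  linarith

theorem re_pole_nonneg {a : ℂ} (ha : ‖a‖ = 1) (hr : 0 ≤ r) (hM : 0 ≤ M) (hz : ‖z‖ < 1 + r) :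
    0 ≤ ((M * r : ℝ) * (1 + r - starRingEnd ℂ a * z)⁻¹ : ℂ).re := by
  rw [Complex.re_ofReal_mul, Complex.inv_re]
  have := le_re_denominator (r := r) ha z
  exact mul_nonneg (mul_nonneg hM hr) (div_nonneg (by linarith) (Complex.normSq_nonneg _))

theorem re_poleSum_nonneg (hs : ∀ a ∈ s, ‖a‖ = 1) (hr : 0 ≤ r) (hM : 0 ≤ M) (hz : ‖z‖ < 1 + r) :
    0 ≤ (poleSum s r M z).re := by
  rw [poleSum, Complex.re_sum]
  exact Finset.sum_nonneg fun a ha => re_pole_nonneg (hs a ha) hr hM hz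

theorem one_add_re_poleSum_le_norm : 1 + (poleSum s r M z).re ≤ ‖1 + poleSum s r M z‖ := by
  simpa using Complex.re_le_norm (1 + poleSum s r M z)

theorem differentiableOn_peakFunction (hs : ∀ a ∈ s, ‖a‖ = 1) (hr : 0 ≤ r) (hM : 0 ≤ M) :
    DifferentiableOn ℂ (peakFunction s r M) (ball 0 (1 + r)) := by
  have hF : DifferentiableOn ℂ (poleSum s r M) (ball 0 (1 + r)) := by
    unfold poleSum
    refine DifferentiableOn.fun_sum fun a ha => ?_
    refine DifferentiableOn.const_mul (DifferentiableOn.inv (by fun_prop) fun z hz => ?_) _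
    exact denominator_ne_zero (hs a ha) (by simpa using hz)
  refine hF.div (hF.const_add _) fun z hz h => ?_
  have h1 := re_poleSum_nonneg hs hr hM (z := z) (by simpa using hz)
  have h2 := one_add_re_poleSum_le_norm (s := s) (r := r) (M := M) (z := z)
  rw [h, norm_zero] at h2
  linarith

theorem norm_peakFunction_le_norm_poleSum (hs : ∀ a ∈ s, ‖a‖ = 1) (hr : 0 ≤ r) (hM : 0 ≤ M)
    (hz : ‖z‖ < 1 + r) : ‖peakFunction s r M z‖ ≤ ‖poleSum s r M z‖ := by
  have h1 := re_poleSum_nonneg hs hr hM hz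
  have h2 := one_add_re_poleSum_le_norm (s := s) (r := r) (M := M) (z := z)
  rw [peakFunction, norm_div]
  exact div_le_self (norm_nonneg _) (by linarith)

/-- A point `F` with `Re F ≥ 0` is no farther from `0` than from `-1`, so `|F| ≤ |1 + F|`. -/
theorem norm_peakFunction_le_one (hs : ∀ a ∈ s, ‖a‖ = 1) (hr : 0 ≤ r) (hM : 0 ≤ M)
    (hz : ‖z‖ < 1 + r) : ‖peakFunction s r M z‖ ≤ 1 := by
  have h1 := re_poleSum_nonneg hs hr hM hz
  rw [peakFunction, norm_div]
  refine div_le_one_of_le₀ ?_ (norm_nonneg _)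
  rw [← sq_le_sq₀ (norm_nonneg _) (norm_nonneg _), ← Complex.normSq_eq_norm_sq,
    ← Complex.normSq_eq_norm_sq, Complex.normSq_apply, Complex.normSq_apply]
  simp only [Complex.add_re, Complex.add_im, Complex.one_re, Complex.one_im]
  nlinarith

theorem norm_one_sub_peakFunction_le (hs : ∀ a ∈ s, ‖a‖ = 1) (hr : 0 < r) (hM : 0 < M)
    (hz : ‖z‖ ≤ 1) {a : ℂ} (ha : a ∈ s) (hza : ‖z - a‖ ≤ r) :
    ‖1 - peakFunction s r M z‖ ≤ 4 / M := by
  have hz' : ‖z‖ < 1 + r := by linarith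
  have hw : ‖(1 + r - starRingEnd ℂ a * z : ℂ)‖ ≤ 2 * r := by
    have haa : starRingEnd ℂ a * a = 1 := by
      rw [mul_comm, Complex.mul_conj, Complex.normSq_eq_norm_sq, hs a ha]; simp
    have : (1 + r - starRingEnd ℂ a * z : ℂ) = r - starRingEnd ℂ a * (z - a) := by
      rw [mul_sub, haa]; ring
    rw [this]
    refine (norm_sub_le _ _).trans ?_
    rw [norm_mul, RCLike.norm_conj, hs a ha, Complex.norm_real, Real.norm_of_nonneg hr.le]
    linarith
  -- With `w` the denominator, `Re w⁻¹ = Re w / |w|² ≥ r / (2r)²`. The other poles only add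
  -- nonnegative real parts.
  have hpole : M / 4 ≤ ((M * r : ℝ) * (1 + r - starRingEnd ℂ a * z)⁻¹ : ℂ).re := by
    have hw0 := denominator_ne_zero (hs a ha) hz'
    have hre := le_re_denominator (r := r) (hs a ha) z
    rw [Complex.re_ofReal_mul, Complex.inv_re, Complex.normSq_eq_norm_sq, ← mul_div_assoc,
      le_div_iff₀ (by positivity)]
    have h1 : ‖(1 + r - starRingEnd ℂ a * z : ℂ)‖ ^ 2 ≤ (2 * r) ^ 2 := by gcongr
    have h2 : M * r * r ≤ M * r * (1 + r - starRingEnd ℂ a * z : ℂ).re := by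
      gcongr; linarith
    nlinarith
  have hF : M / 4 ≤ (poleSum s r M z).re := by
    rw [poleSum, Complex.re_sum]
    exact hpole.trans (Finset.single_le_sum (f := fun a =>
      ((M * r : ℝ) * (1 + r - starRingEnd ℂ a * z)⁻¹ : ℂ).re)
      (fun b hb => re_pole_nonneg (hs b hb) hr.le hM.le hz') ha)
  have h2 := one_add_re_poleSum_le_norm (s := s) (r := r) (M := M) (z := z)
  have h0 : 1 + poleSum s r M z ≠ 0 := norm_pos_iff.1 (by linarith)
  have : 1 - peakFunction s r M z = (1 + poleSum s r M z)⁻¹ := by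
    rw [peakFunction]; field_simp; ring
  rw [this, norm_inv, ← inv_div]
  exact inv_anti₀ (by positivity) (by linarith)

theorem norm_peakFunction_le_of_forall_le_norm_sub (hs : ∀ a ∈ s, ‖a‖ = 1) (hr : 0 < r)
    (hM : 0 ≤ M) (hz : ‖z‖ = 1) {d : ℝ} (hd : 0 < d) (hzd : ∀ a ∈ s, d ≤ ‖z - a‖) :
    ‖peakFunction s r M z‖ ≤ M * (s.card * r) / d := by
  refine (norm_peakFunction_le_norm_poleSum hs hr.le hM (by linarith)).trans ?_
  have : ∀ a ∈ s, ‖((M * r : ℝ) * (1 + r - starRingEnd ℂ a * z)⁻¹ : ℂ)‖ ≤ M * r * d⁻¹ := by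
    intro a ha
    rw [norm_mul, Complex.norm_real, Real.norm_of_nonneg (by positivity), norm_inv]
    gcongr
    refine (hzd a ha).trans ?_
    have hzz : ‖starRingEnd ℂ a * z‖ = 1 := by simp [hs a ha, hz]
    have haa : starRingEnd ℂ a * a = 1 := by
      rw [mul_comm, Complex.mul_conj, Complex.normSq_eq_norm_sq, hs a ha]; simp
    have h1 : ‖z - a‖ = ‖1 - starRingEnd ℂ a * z‖ := by
      rw [← haa, ← mul_sub, norm_mul, RCLike.norm_conj, hs a ha, one_mul, norm_sub_rev]
    -- Since `Re (conj a * z) ≤ 1`, moving `1` to `1 + r` only increases the distance to `conj a *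
    -- z`.
    rw [h1, ← sq_le_sq₀ (norm_nonneg _) (norm_nonneg _), ← Complex.normSq_eq_norm_sq,
      ← Complex.normSq_eq_norm_sq, Complex.normSq_apply, Complex.normSq_apply]
    have hre : (starRingEnd ℂ a * z).re ≤ 1 := hzz ▸ Complex.re_le_norm _
    simp only [Complex.add_re, Complex.add_im, Complex.sub_re, Complex.sub_im, Complex.one_re,
      Complex.one_im, Complex.ofReal_re, Complex.ofReal_im]
    nlinarith
  calc ‖poleSum s r M z‖ ≤ ∑ a ∈ s, M * r * d⁻¹ := norm_sum_le_of_le _ this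
    _ = M * (s.card * r) / d := by rw [Finset.sum_const, nsmul_eq_mul]; ring

end PeakFunction

/-! ### Characters of the circle and holomorphic test functions. -/

section Circle

variable {T : ℝ}

theorem fourier_natCast_apply (n : ℕ) (t : AddCircle T) :
    fourier (n : ℤ) t = (fourier 1 t) ^ n := by
  simp [fourier_apply, AddCircle.toCircle_nsmul]

theorem norm_fourier_apply (n : ℤ) (t : AddCircle T) : ‖fourier n t‖ = 1 :=
  Circle.norm_coe _

variable {ν : Measure (AddCircle T)} {h : AddCircle T → ℂ}

theorem integrable_fourier_mul (hh : Integrable h ν) (n : ℤ) :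
    Integrable (fun t => fourier n t * h t) ν :=
  hh.bdd_mul (c := 1) (fourier n).continuous.aestronglyMeasurable
    (Eventually.of_forall fun t => (norm_fourier_apply n t).le)

/-- A measure annihilating all characters of positive frequency annihilates `z * G z` for `G`
holomorphic in a neighbourhood of the closed unit disc. -/
theorem integral_fourier_one_mul_holomorphic_eq_zero (hh : Integrable h ν)
    (hpos : ∀ n : ℤ, 0 < n → ∫ t, fourier n t * h t ∂ν = 0) {G : ℂ → ℂ} {R : ℝ} (hR : 1 < R)
    (hG : DifferentiableOn ℂ G (ball 0 R)) :
    ∫ t, fourier 1 t * G (fourier 1 t) * h t ∂ν = 0 := by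
  set c : ℕ → ℂ := fun n => (n.factorial : ℂ)⁻¹ * iteratedDeriv n G 0 with hc
  have hsum : ∀ z : ℂ, ‖z‖ = 1 → HasSum (fun n => c n * z ^ n) (G z) := by
    intro z hz
    have := Complex.hasSum_taylorSeries_on_ball hG (z := z) (by simpa [hz] using hR)
    have hterm : (fun n => c n * z ^ n) =
        fun n : ℕ => (n.factorial : ℂ)⁻¹ • (z - 0) ^ n • iteratedDeriv n G 0 := by
      ext n
      rw [sub_zero, smul_eq_mul, smul_eq_mul, hc]
      ring
    rw [hterm]
    exact this
  -- The disc of holomorphy contains `z = 1`, where the Taylor series converges absolutely; this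
  -- justifies integrating termwise.
  have hcs : Summable fun n => ‖c n‖ := by
    have := (hsum 1 (by simp)).summable.norm
    simpa using this
  have heq : ∀ t : AddCircle T, fourier 1 t * G (fourier 1 t) * h t =
      ∑' n : ℕ, c n * (fourier ((n + 1 : ℕ) : ℤ) t * h t) := by
    intro t
    rw [← ((hsum _ (norm_fourier_apply 1 t)).mul_left (fourier 1 t * h t)).tsum_eq.trans
      (by ring : _ = fourier 1 t * G (fourier 1 t) * h t)]
    congr 1
    ext n
    rw [fourier_natCast_apply]
    ring
  rw [integral_congr_ae (Eventually.of_forall heq), ← (hasSum_integral_of_summable_integral_norm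
    (fun n => (integrable_fourier_mul hh _).const_mul (c n)) ?_).tsum_eq]
  · simp only [integral_const_mul]
    simp only [fun n : ℕ => hpos ((n + 1 : ℕ) : ℤ) (by positivity), mul_zero, tsum_zero]
  · simp only [norm_mul, norm_fourier_apply, one_mul, integral_const_mul]
    exact hcs.mul_right _

theorem measureFourierCoeff_withDensityᵥ {ν : Measure (AddCircle T)} {h : AddCircle T → ℂ}
    (hh : Integrable h ν) (n : ℤ) :
    measureFourierCoeff (ν.withDensityᵥ h) n = ∫ t, fourier (-n) t * h t ∂ν :=
  integral_withDensityᵥ_of_bounded hh (fourier (-n)).continuous.stronglyMeasurable (C := 1)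
    (fun t => (norm_fourier_apply (-n) t).le) zero_le_one

/-! ### Covers of null compact sets and their peak functions. -/

variable [hT : Fact (0 < T)]

theorem norm_fourier_one_sub_le (t a : AddCircle T) :
    ‖fourier 1 t - fourier 1 a‖ ≤ 2 * Real.pi / T * dist t a := by
  have hT0 : 0 < T := hT.out
  have key : ∀ u : AddCircle T, ‖fourier 1 u - 1‖ ≤ 2 * Real.pi / T * ‖u‖ := by
    intro u
    induction u using QuotientAddGroup.induction_on with
    | H x =>
    -- The representative nearest to `0`, so `|y|` is the quotient norm.
    set y := x - round (T⁻¹ * x) * T with hy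
    have hxy : ((x : ℝ) : AddCircle T) = (y : AddCircle T) := by
      rw [hy, AddCircle.coe_sub, eq_comm, sub_eq_self, ← zsmul_eq_mul, AddCircle.coe_zsmul,
        AddCircle.coe_period, smul_zero]
    have hn : ‖((x : ℝ) : AddCircle T)‖ = |y| := AddCircle.norm_eq T
    change ‖fourier 1 ((x : ℝ) : AddCircle T) - 1‖ ≤ 2 * Real.pi / T * ‖((x : ℝ) : AddCircle T)‖
    rw [hn, hxy, fourier_coe_apply]
    have := Real.norm_exp_I_mul_ofReal_sub_one_le (x := 2 * Real.pi / T * y)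
    rw [Real.norm_eq_abs, abs_mul, abs_of_pos (by positivity)] at this
    refine le_trans (le_of_eq ?_) this
    congr 3
    push_cast
    ring
  have h : fourier 1 t - fourier 1 a = fourier 1 a * (fourier 1 (t - a) - 1) := by
    rw [mul_sub, ← sub_eq_zero]
    have : fourier 1 a * fourier 1 (t - a) = fourier 1 t := by
      simp only [fourier_one]
      rw [← Circle.coe_mul, ← AddCircle.toCircle_add, add_sub_cancel]
    rw [this]; ring
  rw [h, norm_mul, norm_fourier_apply, one_mul, dist_eq_norm]
  exact key _

/-- The thickenings of `K` have volume tending to `0`, which limits how many disjoint balls of one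
radius can be centred in `K`. A common radius is what `poleSum` requires. -/
theorem exists_finset_cover_of_isCompact_of_volume_eq_zero {K : Set (AddCircle T)}
    (hK : IsCompact K) (hK0 : volume K = 0) {ε : ℝ} (hε : 0 < ε) :
    ∃ (s : Finset (AddCircle T)) (r : ℝ), 0 < r ∧ ↑s ⊆ K ∧
      (∀ t ∈ K, ∃ a ∈ s, dist t a ≤ r) ∧ s.card * r ≤ ε := by
  have hT0 : 0 < T := hT.out
  have hlim := tendsto_measure_cthickening_of_isCompact (μ := volume) hK
  rw [hK0] at hlim
  -- The bound `δ ≤ T / 2` keeps balls from wrapping around, so their volume is exactly `2 * δ`.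
  have hev : ∀ᶠ δ in 𝓝[>] (0 : ℝ), volume (cthickening δ K) < ENNReal.ofReal (ε / 4) ∧ δ ≤ T / 2 ∧
      0 < δ := by
    filter_upwards [nhdsWithin_le_nhds (hlim.eventually_lt_const
        (by simpa using hε : (0 : ℝ≥0∞) < ENNReal.ofReal (ε / 4))),
      nhdsWithin_le_nhds (eventually_le_nhds (by positivity : (0 : ℝ) < T / 2)),
      self_mem_nhdsWithin] with δ h1 h2 h3 using ⟨h1, h2, h3⟩
  obtain ⟨δ, hδ, hδT, hδ0⟩ := hev.exists
  obtain ⟨u, huK, hdisj, hcov⟩ := Vitali.exists_disjoint_subfamily_covering_enlargement_closedBall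
    K (fun t : AddCircle T => t) (fun _ => δ) δ (fun _ _ => le_rfl) 4 (by norm_num)
  have hvol : ∀ x : AddCircle T, volume (closedBall x δ) = ENNReal.ofReal (2 * δ) := fun x => by
    rw [AddCircle.volume_closedBall, min_eq_right (by linarith)]
  have hcard : ∀ v : Finset (AddCircle T), ↑v ⊆ u → (v.card : ℝ) * (4 * δ) ≤ ε := by
    intro v hv
    have h1 : volume (⋃ a ∈ v, closedBall a δ) = ∑ a ∈ v, volume (closedBall a δ) :=
      measure_biUnion_finset (hdisj.subset hv) fun a _ => isClosed_closedBall.measurableSet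
    have h2 : volume (⋃ a ∈ v, closedBall a δ) ≤ volume (cthickening δ K) :=
      measure_mono (Set.iUnion₂_subset fun a ha =>
        closedBall_subset_cthickening (huK (hv ha)) δ)
    simp only [h1, hvol, Finset.sum_const, nsmul_eq_mul] at h2
    have h3 := h2.trans hδ.le
    rw [← ENNReal.ofReal_natCast, ← ENNReal.ofReal_mul (by positivity),
      ENNReal.ofReal_le_ofReal_iff (by positivity)] at h3
    linarith
  -- The bound `hcard` is uniform over finite subfamilies, so the whole family is finite.
  have hfin : u.Finite := by
    by_contra hinf
    obtain ⟨n, hn⟩ := exists_nat_gt (ε / (4 * δ))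
    obtain ⟨v, hvu, hvn⟩ := (show u.Infinite from hinf).exists_subset_card_eq n
    have := hcard v hvu
    rw [hvn, ← le_div_iff₀ (by positivity)] at this
    linarith
  refine ⟨hfin.toFinset, 4 * δ, by positivity, by simpa using huK, fun t ht => ?_,
    hcard _ (by simp)⟩
  obtain ⟨b, hb, hsub⟩ := hcov t ht
  exact ⟨b, by simpa using hb, hsub (mem_closedBall_self hδ0.le)⟩

theorem exists_peak_function {K : Set (AddCircle T)} (hK : IsCompact K) (hK0 : volume K = 0)
    {M η : ℝ} (hM : 0 < M) (hη : 0 < η) :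
    ∃ (G : ℂ → ℂ) (R : ℝ), 1 < R ∧ DifferentiableOn ℂ G (ball 0 R) ∧
      (∀ z, ‖z‖ ≤ 1 → ‖G z‖ ≤ 1) ∧ (∀ t ∈ K, ‖1 - G (fourier 1 t)‖ ≤ 4 / M) ∧
      ∀ t : AddCircle T, ∀ d > 0, (∀ a ∈ K, d ≤ ‖(fourier 1 t : ℂ) - fourier 1 a‖) →
        ‖G (fourier 1 t)‖ ≤ η / d := by
  classical
  have hT0 : 0 < T := hT.out
  have hc : 0 < 2 * Real.pi / T := by positivity
  -- This `ε` absorbs the height `M` and the Lipschitz constant `2π / T` of the character, leaving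
  -- `η` in the final bound.
  obtain ⟨s, r, hr, hsK, hcov, hcard⟩ := exists_finset_cover_of_isCompact_of_volume_eq_zero hK hK0
    (ε := η / M / (2 * Real.pi / T)) (by positivity)
  set s' : Finset ℂ := s.image fun a => fourier 1 a with hs'
  set ρ := 2 * Real.pi / T * r with hρ
  have hρ0 : 0 < ρ := by positivity
  have hs1 : ∀ a ∈ s', ‖a‖ = 1 := by
    intro a ha
    obtain ⟨b, -, rfl⟩ := Finset.mem_image.1 ha
    exact norm_fourier_apply _ _
  refine ⟨peakFunction s' ρ M, 1 + ρ, by linarith, differentiableOn_peakFunction hs1 hρ0.le hM.le,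
    fun z hz => norm_peakFunction_le_one hs1 hρ0.le hM.le (by linarith), fun t ht => ?_,
    fun t d hd htd => ?_⟩
  · obtain ⟨a, ha, hta⟩ := hcov t ht
    refine norm_one_sub_peakFunction_le hs1 hρ0 hM (norm_fourier_apply _ _).le
      (Finset.mem_image_of_mem _ ha) ((norm_fourier_one_sub_le t a).trans
        (mul_le_mul_of_nonneg_left hta hc.le))
  · refine (norm_peakFunction_le_of_forall_le_norm_sub hs1 hρ0 hM.le (norm_fourier_apply _ _) hd
      fun a ha => ?_).trans ?_
    · obtain ⟨b, hb, rfl⟩ := Finset.mem_image.1 ha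
      exact htd b (hsK hb)
    · gcongr
      have h1 : (s'.card : ℝ) ≤ s.card := by exact_mod_cast Finset.card_image_le
      calc M * (s'.card * ρ) ≤ M * (s.card * ρ) := by gcongr
        _ = M * (2 * Real.pi / T) * (s.card * r) := by rw [hρ]; ring
        _ ≤ M * (2 * Real.pi / T) * (η / M / (2 * Real.pi / T)) := by gcongr
        _ = η := by field_simp

/-! ### The F. and M. Riesz theorem. -/

theorem setIntegral_fourier_one_mul_eq_zero_of_isCompact (hh : Integrable h ν)
    (hpos : ∀ n : ℤ, 0 < n → ∫ t, fourier n t * h t ∂ν = 0) {K : Set (AddCircle T)}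
    (hK : IsCompact K) (hK0 : volume K = 0) : ∫ t in K, fourier 1 t * h t ∂ν = 0 := by
  -- Letting `M → ∞` forces `G → 1` on `K`; letting `η → 0` forces `G → 0` at each point off `K`, at
  -- a rate depending on its distance to `K`.
  choose G R hR hG hG1 hGK hGd using fun n : ℕ => exists_peak_function hK hK0
    (M := (n : ℝ) + 1) (η := 1 / ((n : ℝ) + 1)) (by positivity) (by positivity)
  have hzero := fun n => integral_fourier_one_mul_holomorphic_eq_zero hh hpos (hR n) (hG n)
  have hη : Tendsto (fun n : ℕ => 1 / ((n : ℝ) + 1)) atTop (𝓝 0) :=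
    tendsto_one_div_add_atTop_nhds_zero_nat
  have hcont : ∀ n, Continuous fun t : AddCircle T => G n (fourier 1 t) := fun n =>
    (hG n).continuousOn.comp_continuous (fourier 1).continuous fun t => by
      rw [mem_ball_zero_iff, norm_fourier_apply]
      exact hR n
  have hlim : ∀ t, Tendsto (fun n => G n (fourier 1 t)) atTop
      (𝓝 (K.indicator (fun _ => (1 : ℂ)) t)) := by
    intro t
    by_cases ht : t ∈ K
    · rw [Set.indicator_of_mem ht, tendsto_iff_norm_sub_tendsto_zero]
      refine squeeze_zero (fun _ => norm_nonneg _) (fun n => ?_) (by simpa using hη.const_mul 4)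
      rw [norm_sub_rev]
      exact (hGK n t ht).trans_eq (by ring)
    · rw [Set.indicator_of_notMem ht]
      have hclosed : IsClosed ((fun a : AddCircle T => (fourier 1 a : ℂ)) '' K) :=
        (hK.image (fourier 1).continuous).isClosed
      have hnot : (fourier 1 t : ℂ) ∉ (fun a : AddCircle T => (fourier 1 a : ℂ)) '' K := by
        rintro ⟨a, ha, hat⟩
        simp only [fourier_one, Circle.coe_inj] at hat
        exact ht (AddCircle.injective_toCircle hT.out.ne' hat ▸ ha)
      obtain ⟨d, hd, hball⟩ := Metric.isOpen_iff.1 hclosed.isOpen_compl _ hnot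
      refine squeeze_zero_norm (fun n => hGd n t d hd fun a ha => ?_)
        (by simpa using hη.div_const d)
      by_contra! hlt
      exact hball (by rwa [mem_ball', dist_eq_norm]) ⟨a, ha, rfl⟩
  have hconv : Tendsto (fun n => ∫ t, fourier 1 t * G n (fourier 1 t) * h t ∂ν) atTop
      (𝓝 (∫ t, fourier 1 t * K.indicator (fun _ => (1 : ℂ)) t * h t ∂ν)) := by
    refine tendsto_integral_of_dominated_convergence (fun t => ‖h t‖)
      (fun n => (((fourier 1).continuous.mul (hcont n)).aestronglyMeasurable).mul hh.1)
      hh.norm (fun n => Eventually.of_forall fun t => ?_)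
      (Eventually.of_forall fun t => ((hlim t).const_mul _).mul_const _)
    rw [norm_mul, norm_mul, norm_fourier_apply, one_mul]
    exact mul_le_of_le_one_left (norm_nonneg _) (hG1 n _ (norm_fourier_apply _ _).le)
  simp only [hzero] at hconv
  rw [tendsto_nhds_unique tendsto_const_nhds hconv, ← integral_indicator hK.measurableSet]
  congr 1
  ext t
  by_cases ht : t ∈ K <;> simp [ht]

theorem setIntegral_fourier_one_mul_eq_zero [IsFiniteMeasure ν] (hh : Integrable h ν)
    (hpos : ∀ n : ℤ, 0 < n → ∫ t, fourier n t * h t ∂ν = 0) {s : Set (AddCircle T)}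
    (hs : MeasurableSet s) (hs0 : volume s = 0) : ∫ t in s, fourier 1 t * h t ∂ν = 0 := by
  -- Inner regularity is used for `ν`, while Lebesgue nullity passes to the subsets `K n`.
  choose K hKs hK hKν using fun n : ℕ => hs.exists_isCompact_sdiff_lt (measure_ne_top ν s)
    (ε := ((n : ℝ≥0∞) + 1)⁻¹) (by simp)
  have hint := integrable_fourier_mul hh 1
  have hlim : Tendsto (fun n => ν (s \ K n)) atTop (𝓝 0) := by
    refine tendsto_of_tendsto_of_tendsto_of_le_of_le tendsto_const_nhds ?_ (fun _ => zero_le)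
      (fun n => (hKν n).le)
    have := (tendsto_add_atTop_iff_nat 1).2 ENNReal.tendsto_inv_nat_nhds_zero
    simpa using this
  refine tendsto_nhds_unique ?_ (hint.tendsto_setIntegral_nhds_zero hlim)
  refine tendsto_const_nhds.congr fun n => ?_
  rw [setIntegral_sdiff (hK n).measurableSet hint.integrableOn (hKs n),
    setIntegral_fourier_one_mul_eq_zero_of_isCompact hh hpos (hK n)
      (measure_mono_null (hKs n) hs0), sub_zero]

/-- **F. and M. Riesz theorem**, for a measure given by a density. -/
theorem setIntegral_eq_zero_of_volume_eq_zero [IsFiniteMeasure ν] (hh : Integrable h ν)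
    (hpos : ∀ n : ℤ, 0 < n → ∫ t, fourier n t * h t ∂ν = 0) {s : Set (AddCircle T)}
    (hs : MeasurableSet s) (hs0 : volume s = 0) : ∫ t in s, h t ∂ν = 0 := by
  -- Every measurable subset of `s` is also null, so the integral of `z h` vanishes on all of them;
  -- this pointwise conclusion lets the factor `z` be cancelled.
  have hae : (fun t => fourier 1 t * h t) =ᵐ[ν.restrict s] 0 := by
    refine (integrable_fourier_mul hh 1).restrict.ae_eq_zero_of_forall_setIntegral_eq_zero
      fun u hu _ => ?_
    rw [Measure.restrict_restrict hu]
    exact setIntegral_fourier_one_mul_eq_zero hh hpos (hu.inter hs)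
      (measure_mono_null Set.inter_subset_right hs0)
  refine integral_eq_zero_of_ae (hae.mono fun t ht => ?_)
  have h1 : (fourier 1 t : ℂ) ≠ 0 := norm_pos_iff.1 (by simp)
  exact (mul_eq_zero.1 ht).resolve_left h1

theorem volume_eq_zero_of_haarAddCircle_eq_zero {s : Set (AddCircle T)}
    (hs : haarAddCircle s = 0) : volume s = 0 := by
  rw [volume_eq_smul_haarAddCircle, Measure.smul_apply, hs, smul_zero]

/-- **F. and M. Riesz theorem**. -/
theorem absolutelyContinuous_haarAddCircle_of_forall_neg (μ : ComplexMeasure (AddCircle T))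
    (hneg : ∀ n : ℤ, n < 0 → measureFourierCoeff μ n = 0) :
    μ ≪ᵥ (haarAddCircle (T := T)).toENNRealVectorMeasure := by
  obtain ⟨ν, _, h, hh, rfl⟩ := exists_finite_measure_eq_withDensityᵥ μ
  refine VectorMeasure.AbsolutelyContinuous.mk fun s hs hs0 => ?_
  rw [Measure.toENNRealVectorMeasure_apply_measurable hs] at hs0
  rw [withDensityᵥ_apply hh hs]
  refine setIntegral_eq_zero_of_volume_eq_zero hh (fun n hn => ?_) hs
    (volume_eq_zero_of_haarAddCircle_eq_zero hs0)
  have := hneg (-n) (by omega)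
  rwa [measureFourierCoeff_withDensityᵥ hh, neg_neg] at this

theorem variation_withDensityᵥ_univ_eq_norm {α : Type*} [MeasurableSpace α] {ν : Measure α}
    (f : Lp ℂ 1 ν) : (ν.withDensityᵥ f).variation Set.univ = ENNReal.ofReal ‖f‖ := by
  rw [Measure.variation_withDensityᵥ (L1.integrable_coeFn f), withDensity_apply _ .univ,
    Measure.restrict_univ, L1.norm_def, ENNReal.ofReal_toReal]
  exact (L1.integrable_coeFn f).2.ne

end Circle

end RealHardy

theorem mainTheorem9 (T : ℝ) [Fact (0 < T)]
    (μ : MeasureTheory.ComplexMeasure (AddCircle T)) (hμ : μ ∈ RealHardy.Mr T)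
    (hneg : ∀ n : ℤ, n < 0 → RealHardy.measureFourierCoeff μ n = 0) :
    MeasureTheory.VectorMeasure.AbsolutelyContinuous μ
        (AddCircle.haarAddCircle (T := T)).toENNRealVectorMeasure ∧
      ∃ f ∈ RealHardy.H1r T,
        μ = (AddCircle.haarAddCircle (T := T)).withDensityᵥ f ∧
        RealHardy.totalVariationNorm μ = ENNReal.ofReal ‖f‖ := by
  have hac := RealHardy.absolutelyContinuous_haarAddCircle_of_forall_neg μ hneg
  obtain ⟨g, hg, hμg⟩ := RealHardy.exists_eq_withDensityᵥ_of_absolutelyContinuous μ _ hac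
  have hμf : μ = (AddCircle.haarAddCircle (T := T)).withDensityᵥ (hg.toL1 g) :=
    hμg.trans (MeasureTheory.WithDensityᵥEq.congr_ae hg.coeFn_toL1.symm)
  have hcoeff : ∀ n, fourierCoeff (hg.toL1 g) n = RealHardy.measureFourierCoeff μ n := fun n => by
    rw [hμf, RealHardy.measureFourierCoeff_withDensityᵥ (MeasureTheory.L1.integrable_coeFn _)]
    rfl
  refine ⟨hac, hg.toL1 g, ⟨fun n => ?_, fun n hn => ?_⟩, hμf, ?_⟩
  · rw [hcoeff]
    exact hμ n
  · rw [hcoeff]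
    exact hneg n hn
  · rw [RealHardy.totalVariationNorm]
    nth_rw 1 [hμf]
    exact RealHardy.variation_withDensityᵥ_univ_eq_norm _
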